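/- Let $\mathbb{K}$ be a field of characteristic zero. A graded filtered Lie algebra is a Lie algebra $\mathfrak{g}$ over $\mathbb{K}$ together with a direct sum decomposition $\mathfrak{g}=\bigoplus_{n\in\mathbb{N}}\mathfrak{g}_n$ into subspaces and a decreasing filtration $\mathfrak{g}=\mathfrak{g}^{(0)}\supseteq\mathfrak{g}^{(1)}\supseteq\mathfrak{g}^{(2)}\supseteq\cdots$ by subspaces such that, with $\mathfrak{g}^{(k)}_n=\mathfrak{g}_n\cap\mathfrak{g}^{(k)}$, one has $\mathfrak{g}^{(k)}=\bigoplus_{n\in\mathbb{N}}\mathfrak{g}^{(k)}_n$ for all $k$, and $[\mathfrak{g}^{(k)}_m,\mathfrak{g}^{(l)}_n]\subseteq\mathfrak{g}^{(k+l)}_{m+n}$ for all $k,l,m,n\in\mathbb{N}$. It is connected if $\mathfrak{g}_0=(0)$, and locally finite if for every $n\in\mathbb{N}$ there exists $k\in\mathbb{N}$ with $\mathfrak{g}^{(k)}_n=(0)$. Its associated graded Lie algebra is $$\mathrm{Gr}(\mathfrak{g})=\bigoplus_{n\in\mathbb{N}}\bigoplus_{k\in\mathbb{N}}\mathfrak{g}^{(k)}_n/\mathfrak{g}^{(k+1)}_n,$$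 with the bracket for which the bracket of the classes of $x\in\mathfrak{g}^{(k)}_m$ and $y\in\mathfrak{g}^{(l)}_n$ is the class of $[x,y]$ in $\mathfrak{g}^{(k+l)}_{m+n}/\mathfrak{g}^{(k+l+1)}_{m+n}$. (No finite-dimensionality is assumed.) **Proposition 3.5.** Let $\mathfrak{g}$ be a connected and locally finite graded filtered Lie algebra over $\mathbb{K}$. If $\mathrm{Gr}(\mathfrak{g})$ is a free Lie algebra over $\mathbb{K}$, then $\mathfrak{g}$ is a free Lie algebra over $\mathbb{K}$. -/

import Mathlib

open scoped DirectSum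

/-- A graded filtered Lie algebra structure on the Lie algebra `g` over the field `K`: a grading
`g = ⨁ₙ deg n` by subspaces and a decreasing exhaustive filtration
`g = fil 0 ⊇ fil 1 ⊇ fil 2 ⊇ ⋯` by graded subspaces, such that
`⁅gₘ⁽ᵏ⁾, gₙ⁽ˡ⁾⁆ ⊆ gₘ₊ₙ⁽ᵏ⁺ˡ⁾`, where `gₙ⁽ᵏ⁾ = deg n ⊓ fil k`. -/
structure GradedFilteredLieAlgebra (K g : Type*) [Field K] [LieRing g] [LieAlgebra K g] where
  /-- The homogeneous component of degree `n`. -/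
  deg : ℕ → Submodule K g
  /-- The `k`-th step of the filtration. -/
  fil : ℕ → Submodule K g
  isInternal : DirectSum.IsInternal deg
  antitone : Antitone fil
  fil_zero : fil 0 = ⊤
  /-- Every step of the filtration is spanned by its homogeneous elements (the sum is
  automatically direct, being a sum of subspaces of the components). -/
  fil_eq : ∀ k, fil k = ⨆ n, deg n ⊓ fil k
  lie_mem : ∀ {m n k l : ℕ} {x y : g}, x ∈ deg m ⊓ fil k → y ∈ deg n ⊓ fil l →
    ⁅x, y⁆ ∈ deg (m + n) ⊓ fil (k + l)

/-- A Lie algebra is free if it has a subset `X` which freely generates it: the morphism from the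
free Lie algebra on `X` that extends the inclusion of `X` is an isomorphism. -/
def IsFreeLieAlgebra (K L : Type*) [Field K] [LieRing L] [LieAlgebra K L] : Prop :=
  ∃ X : Set L, Function.Bijective (FreeLieAlgebra.lift K (fun x : X => (x : L)))

namespace GradedFilteredLieAlgebra

variable {K g : Type*} [Field K] [LieRing g] [LieAlgebra K g]

/-- The component of degree zero vanishes. -/
def IsConnected (G : GradedFilteredLieAlgebra K g) : Prop := G.deg 0 = ⊥

/-- In each degree the filtration reaches zero. -/
def IsLocallyFinite (G : GradedFilteredLieAlgebra K g) : Prop :=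
  ∀ n, ∃ k, G.deg n ⊓ G.fil k = ⊥

variable (G : GradedFilteredLieAlgebra K g)

/-- `gₙ⁽ᵏ⁾`, where `p = (n, k)`. -/
def comp (p : ℕ × ℕ) : Submodule K g := G.deg p.1 ⊓ G.fil p.2

/-- `gₙ⁽ᵏ⁺¹⁾` as a subspace of `gₙ⁽ᵏ⁾`, where `p = (n, k)`. -/
def next (p : ℕ × ℕ) : Submodule K (G.comp p) := (G.comp (p.1, p.2 + 1)).submoduleOf (G.comp p)

/-- `gₙ⁽ᵏ⁾ / gₙ⁽ᵏ⁺¹⁾`, where `p = (n, k)`. -/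
abbrev Piece (p : ℕ × ℕ) : Type _ := G.comp p ⧸ G.next p

/-- The associated graded space `Gr(g) = ⨁ₙ ⨁ₖ gₙ⁽ᵏ⁾ / gₙ⁽ᵏ⁺¹⁾`. -/
def Gr : Type _ := ⨁ p : ℕ × ℕ, G.Piece p

noncomputable instance : AddCommGroup G.Gr :=
  inferInstanceAs (AddCommGroup (⨁ p : ℕ × ℕ, G.Piece p))

noncomputable instance : Module K G.Gr :=
  inferInstanceAs (Module K (⨁ p : ℕ × ℕ, G.Piece p))

/-- The identity map of `Gr(g)`, as an isomorphism from the direct sum. -/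
noncomputable def grEquiv : (⨁ p : ℕ × ℕ, G.Piece p) ≃ₗ[K] G.Gr := LinearEquiv.refl K _

/-- The canonical map `gₙ⁽ᵏ⁾ → gₙ⁽ᵏ⁾ / gₙ⁽ᵏ⁺¹⁾ ⊆ Gr(g)`, where `p = (n, k)`. -/
noncomputable def toGr (p : ℕ × ℕ) : G.comp p →ₗ[K] G.Gr :=
  G.grEquiv.toLinearMap ∘ₗ DirectSum.lof K (ℕ × ℕ) G.Piece p ∘ₗ (G.next p).mkQ

theorem toGr_apply (p : ℕ × ℕ) (x : G.comp p) :
    G.toGr p x = G.grEquiv (DirectSum.lof K (ℕ × ℕ) G.Piece p ((G.next p).mkQ x)) := rfl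

/-- The bracket of elements of `gₘ⁽ᵏ⁾` and `gₙ⁽ˡ⁾`, as an element of `gₘ₊ₙ⁽ᵏ⁺ˡ⁾`. -/
def compLie {p q : ℕ × ℕ} (x : G.comp p) (y : G.comp q) : G.comp (p + q) :=
  ⟨⁅(x : g), (y : g)⁆, G.lie_mem x.2 y.2⟩

theorem toGr_congr {p q : ℕ × ℕ} (h : p = q) (x : G.comp p) (y : G.comp q)
    (hxy : (x : g) = y) : G.toGr p x = G.toGr q y := by
  subst h
  rw [Subtype.ext hxy]

theorem toGr_eq_zero {p : ℕ × ℕ} (x : G.comp p) (h : (x : g) ∈ G.comp (p.1, p.2 + 1)) :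
    G.toGr p x = 0 := by
  have h1 : (G.next p).mkQ x = 0 := by
    rw [Submodule.mkQ_apply, Submodule.Quotient.mk_eq_zero]
    exact h
  rw [toGr_apply, h1, map_zero, map_zero]

theorem gr_induction {P : G.Gr → Prop} (zero : P 0) (toGr : ∀ p (x : G.comp p), P (G.toGr p x))
    (add : ∀ a b, P a → P b → P (a + b)) (a : G.Gr) : P a := by
  refine DirectSum.induction_on (β := G.Piece) a zero (fun p x => ?_) add
  obtain ⟨x, rfl⟩ := Submodule.mkQ_surjective _ x
  exact toGr p x

/-- `(x, y) ↦` class of `⁅x, y⁆`, on representatives. -/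
noncomputable def lieRep (p q : ℕ × ℕ) : G.comp p →ₗ[K] G.comp q →ₗ[K] G.Gr :=
  LinearMap.mk₂ K (fun x y => G.toGr (p + q) (G.compLie x y))
    (fun x x' y => by rw [← map_add]; congr 1; exact Subtype.ext (add_lie _ _ _))
    (fun c x y => by rw [← map_smul]; congr 1; exact Subtype.ext (smul_lie _ _ _))
    (fun x y y' => by rw [← map_add]; congr 1; exact Subtype.ext (lie_add _ _ _))
    (fun c x y => by rw [← map_smul]; congr 1; exact Subtype.ext (lie_smul _ _ _))

/-- The bracket of two pieces of `Gr(g)`, induced by the bracket of representatives. -/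
noncomputable def liePiece (p q : ℕ × ℕ) : G.Piece p →ₗ[K] G.Piece q →ₗ[K] G.Gr :=
  ((G.next q).liftQ
    ((G.next p).liftQ (G.lieRep p q) (by
      intro x hx
      ext y
      refine G.toGr_eq_zero _ ?_
      have h := G.lie_mem (k := p.2 + 1) hx y.2
      rwa [add_right_comm] at h)).flip (by
    intro y hy
    ext x
    refine G.toGr_eq_zero _ ?_
    exact G.lie_mem (l := q.2 + 1) x.2 hy)).flip

/-- The bracket of `Gr(g)` as a bilinear map. -/
noncomputable def lieGr : G.Gr →ₗ[K] G.Gr →ₗ[K] G.Gr :=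
  (DirectSum.toModule K (ℕ × ℕ) (G.Gr →ₗ[K] G.Gr) fun p =>
    ((DirectSum.toModule K (ℕ × ℕ) (G.Piece p →ₗ[K] G.Gr)
      fun q => (G.liePiece p q).flip) ∘ₗ G.grEquiv.symm.toLinearMap).flip) ∘ₗ
    G.grEquiv.symm.toLinearMap

theorem lieGr_toGr {p q : ℕ × ℕ} (x : G.comp p) (y : G.comp q) :
    G.lieGr (G.toGr p x) (G.toGr q y) = G.toGr (p + q) (G.compLie x y) := by
  rw [lieGr, LinearMap.comp_apply, toGr_apply, toGr_apply, LinearEquiv.coe_coe,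
    LinearEquiv.symm_apply_apply, DirectSum.toModule_lof, LinearMap.flip_apply,
    LinearMap.comp_apply, LinearEquiv.coe_coe, LinearEquiv.symm_apply_apply,
    DirectSum.toModule_lof]
  rfl

theorem lieGr_skew (a b : G.Gr) : G.lieGr a b + G.lieGr b a = 0 := by
  induction a using G.gr_induction with
  | zero => simp
  | add a a' h h' =>
    rw [map_add, map_add, LinearMap.add_apply, add_add_add_comm, h, h', add_zero]
  | toGr p x =>
    induction b using G.gr_induction with
    | zero => simp
    | add b b' h h' =>
      rw [map_add, map_add, LinearMap.add_apply, add_add_add_comm, h, h', add_zero]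
    | toGr q y =>
      rw [lieGr_toGr, lieGr_toGr,
        G.toGr_congr (add_comm q p) (G.compLie y x) (-(G.compLie x y)) (lie_skew _ _).symm,
        map_neg, add_neg_cancel]

theorem lieGr_self (a : G.Gr) : G.lieGr a a = 0 := by
  induction a using G.gr_induction with
  | zero => simp
  | toGr p x =>
    rw [lieGr_toGr, show G.compLie x x = 0 from Subtype.ext (lie_self _), map_zero]
  | add a b h h' =>
    rw [map_add, map_add, LinearMap.add_apply, LinearMap.add_apply, h, h', zero_add, add_zero]
    rw [add_comm]
    exact G.lieGr_skew a b

theorem lieGr_leibniz (a b c : G.Gr) :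
    G.lieGr a (G.lieGr b c) = G.lieGr (G.lieGr a b) c + G.lieGr b (G.lieGr a c) := by
  induction a using G.gr_induction with
  | zero => simp
  | add a a' h h' =>
    simp only [map_add, LinearMap.add_apply, h, h']
    abel
  | toGr p x =>
    induction b using G.gr_induction with
    | zero => simp
    | add b b' h h' =>
      simp only [map_add, LinearMap.add_apply, h, h']
      abel
    | toGr q y =>
      induction c using G.gr_induction with
      | zero => simp
      | add c c' h h' =>
        simp only [map_add, h, h']
        abel
      | toGr r z =>
        simp only [lieGr_toGr]
        rw [G.toGr_congr (add_left_comm q p r) (G.compLie y (G.compLie x z))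
            ⟨_, (add_left_comm q p r) ▸ (G.compLie y (G.compLie x z)).2⟩ rfl,
          G.toGr_congr (add_assoc p q r) (G.compLie (G.compLie x y) z)
            ⟨_, (add_assoc p q r) ▸ (G.compLie (G.compLie x y) z).2⟩ rfl, ← map_add]
        exact G.toGr_congr rfl _ _ (leibniz_lie _ _ _)

/-- The Lie bracket of `Gr(g)`; it is determined by `lie_toGr`. -/
noncomputable instance : LieRing G.Gr where
  bracket a b := G.lieGr a b
  add_lie a b c := LinearMap.map_add₂ _ a b c
  lie_add a b c := map_add (G.lieGr a) b c
  lie_self := G.lieGr_self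
  leibniz_lie := G.lieGr_leibniz

noncomputable instance : LieAlgebra K G.Gr where
  lie_smul c a b := map_smul (G.lieGr a) c b

theorem lie_toGr {p q : ℕ × ℕ} (x : G.comp p) (y : G.comp q) :
    ⁅G.toGr p x, G.toGr q y⁆ = G.toGr (p + q) (G.compLie x y) := G.lieGr_toGr x y

end GradedFilteredLieAlgebra

/-! `Gr(g)` is bigraded, and its degree-zero part vanishes because `g` is connected. Such a graded
free Lie algebra has free homogeneous generators (`IsFreeLieAlgebra.exists_homogeneous_generators`):
lift bases of its components modulo brackets. Induction on the degree shows that the lifts generate.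
For freeness, let `φ : F → L` be the resulting surjection from a free Lie algebra; its kernel `R`
lies in `[F, F]`. Since `L` is free, `φ` splits, and the splitting forces `R ⊆ [F, R]`; residual
nilpotence of `F` (`FreeLieAlgebra.eq_bot_of_le_span_lie`) then gives `R = 0`.

Representatives in `g` of homogeneous free generators of `Gr(g)` freely generate `g`. The two
induced maps from the free Lie algebra, to `g` and to `Gr(g)`, agree on leading terms. A relation in
`g` would thus yield one in `Gr(g)` (`liftFree_injective`), and an element of `g` is approximated
ever deeper in the filtration, which stops in each degree by local finiteness
(`liftFree_surjective`). -/

open scoped TensorProduct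

/-! ### Generation and residual nilpotence of free Lie algebras. -/

namespace FreeLieAlgebra

section Generation

variable {K Y : Type*} [CommRing K]

/-- A Lie subalgebra of a free Lie algebra containing the generators is everything. -/
theorem mem_of_forall_of_mem (S : LieSubalgebra K (FreeLieAlgebra K Y))
    (hS : ∀ y, of K y ∈ S) (f : FreeLieAlgebra K Y) : f ∈ S := by
  have h : S.incl.comp (lift K fun y => (⟨of K y, hS y⟩ : S)) = LieHom.id := by
    ext y
    simp
  have h2 := LieHom.congr_fun h f
  rw [LieHom.comp_apply] at h2
  rw [show f = S.incl ((lift K fun y => (⟨of K y, hS y⟩ : S)) f) from h2.symm]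
  exact Subtype.property _

end Generation

end FreeLieAlgebra

/-- The sum of a family of subspaces closed under brackets is closed under brackets. -/
theorem Submodule.lie_mem_iSup {K L ι : Type*} [CommRing K] [LieRing L] [LieAlgebra K L] [Add ι]
    {A : ι → Submodule K L} (hA : ∀ {i j x y}, x ∈ A i → y ∈ A j → ⁅x, y⁆ ∈ A (i + j))
    {x y : L} (hx : x ∈ ⨆ i, A i) (hy : y ∈ ⨆ i, A i) : ⁅x, y⁆ ∈ ⨆ i, A i := by
  induction hx using Submodule.iSup_induction' with
  | mem i x hx =>
    induction hy using Submodule.iSup_induction' with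
    | mem j y hy => exact Submodule.mem_iSup_of_mem _ (hA hx hy)
    | zero => simp
    | add y y' _ _ h h' =>
      rw [lie_add]
      exact add_mem h h'
  | zero => simp
  | add x x' _ _ h h' =>
    rw [add_lie]
    exact add_mem h h'

namespace FreeLieAlgebra

section Field

variable {K Y : Type*} [Field K]

/-- Subspaces `A i` with `⁅A i, A j⁆ ⊆ A (i + j)` that contain the generators span. -/
theorem iSup_eq_top {ι : Type*} [Add ι] (A : ι → Submodule K (FreeLieAlgebra K Y))
    (hA : ∀ {i j x y}, x ∈ A i → y ∈ A j → ⁅x, y⁆ ∈ A (i + j))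
    (hof : ∀ y, ∃ i, of K y ∈ A i) : ⨆ i, A i = ⊤ := by
  rw [eq_top_iff]
  intro f _
  refine mem_of_forall_of_mem
    ({ toSubmodule := ⨆ i, A i
       lie_mem' := fun hx hy => Submodule.lie_mem_iSup hA hx hy } :
      LieSubalgebra K (FreeLieAlgebra K Y)) (fun y => ?_) f
  obtain ⟨i, hi⟩ := hof y
  exact Submodule.mem_iSup_of_mem i hi

theorem of_injective : Function.Injective (of K : Y → FreeLieAlgebra K Y) := by
  let _ : LieRing (FreeAlgebra K Y) := LieRing.ofAssociativeRing
  let _ : LieAlgebra K (FreeAlgebra K Y) := LieAlgebra.ofAssociativeAlgebra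
  intro x y h
  have h2 := congrArg (lift K (FreeAlgebra.ι K : Y → FreeAlgebra K Y)) h
  rw [lift_of_apply, lift_of_apply] at h2
  exact FreeAlgebra.ι_injective h2

variable (K Y) in
/-- The Lie algebra homomorphism from `F` to `F[X]` that multiplies the generators by `X`. -/
noncomputable def homogenize :
    FreeLieAlgebra K Y →ₗ⁅K⁆ Polynomial K ⊗[K] FreeLieAlgebra K Y :=
  lift K fun y => Polynomial.X ⊗ₜ of K y

/-- The coefficients of a polynomial with coefficients in `L`. -/
noncomputable def tensorCoeff (L : Type*) [AddCommGroup L] [Module K L] :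
    Polynomial K ⊗[K] L ≃ₗ[K] ℕ →₀ L :=
  TensorProduct.equivFinsuppOfBasisLeft (Polynomial.basisMonomials K)

theorem tensorCoeff_tmul {L : Type*} [AddCommGroup L] [Module K L] (p : Polynomial K) (x : L)
    (n : ℕ) : tensorCoeff L (p ⊗ₜ[K] x) n = p.coeff n • x := by
  simp [tensorCoeff]
  rfl

theorem tensorCoeff_lie {L : Type*} [LieRing L] [LieAlgebra K L] (z w : Polynomial K ⊗[K] L)
    (n : ℕ) : tensorCoeff L (LieRing.toBracket.bracket z w) n =
      ∑ p ∈ Finset.HasAntidiagonal.antidiagonal n, ⁅tensorCoeff L z p.1, tensorCoeff L w p.2⁆ := by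
  let B : Polynomial K ⊗[K] L → Polynomial K ⊗[K] L → Polynomial K ⊗[K] L :=
    LieRing.toBracket.bracket
  change tensorCoeff L (B z w) n = _
  induction z using TensorProduct.induction_on with
  | zero =>
    rw [show B 0 w = 0 from zero_lie w]
    simp
  | add z z' h h' =>
    rw [show B (z + z') w = B z w + B z' w from add_lie z z' w]
    simp [h, h', Finset.sum_add_distrib]
  | tmul p x =>
    induction w using TensorProduct.induction_on with
    | zero =>
      rw [show B (p ⊗ₜ x) 0 = 0 from lie_zero (p ⊗ₜ[K] x)]
      simp
    | add z z' h h' =>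
      rw [show B (p ⊗ₜ x) (z + z') = B (p ⊗ₜ x) z + B (p ⊗ₜ x) z' from lie_add (p ⊗ₜ[K] x) z z']
      simp [h, h', Finset.sum_add_distrib]
    | tmul q y =>
      change tensorCoeff L ((p * q) ⊗ₜ ⁅x, y⁆) n = _
      simp only [tensorCoeff_tmul, Polynomial.coeff_mul, Finset.sum_smul, smul_lie, lie_smul,
        smul_smul, mul_comm]

/-- Setting `X = 1` undoes the scaling of the generators. -/
theorem homogenize_injective :
    Function.Injective (homogenize K Y) := by
  rw [injective_iff_map_eq_zero]
  intro f hf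
  let e : FreeLieAlgebra K Y →ₗ⁅K⁆ K ⊗[K] FreeLieAlgebra K Y :=
    { TensorProduct.mk K K (FreeLieAlgebra K Y) 1 with
      map_lie' := fun {x y} => by simp }
  have h : (LieAlgebra.ExtendScalars.map (Polynomial.aeval (1 : K)) LieHom.id).comp (homogenize K Y)
      = e := by
    ext y
    rw [LieHom.comp_apply, homogenize, lift_of_apply]
    change Polynomial.aeval (1 : K) Polynomial.X ⊗ₜ[K] of K y = (1 : K) ⊗ₜ[K] of K y
    rw [Polynomial.aeval_X]
  have h1 := LieHom.congr_fun h f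
  rw [LieHom.comp_apply, hf, map_zero] at h1
  have h2 : TensorProduct.lid K (FreeLieAlgebra K Y) (1 ⊗ₜ f) = 0 := by
    rw [show (1 : K) ⊗ₜ[K] f = 0 from h1.symm, map_zero]
  simpa using h2

/-- Because of this, bracketing with any element raises the lowest power of `X`. -/
theorem tensorCoeff_homogenize_zero (f : FreeLieAlgebra K Y) :
    tensorCoeff _ (homogenize K Y f) 0 = 0 := by
  refine mem_of_forall_of_mem
    { carrier := {f | tensorCoeff _ (homogenize K Y f) 0 = 0}
      add_mem' := fun {a b} ha hb => by
        change tensorCoeff _ (homogenize K Y _) 0 = 0 at ha hb ⊢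
        simp [ha, hb]
      zero_mem' := by simp
      smul_mem' := fun c a ha => by
        change tensorCoeff _ (homogenize K Y _) 0 = 0 at ha ⊢
        simp [ha]
      lie_mem' := fun {a b} ha _ => by
        change tensorCoeff _ (homogenize K Y a) 0 = 0 at ha
        change tensorCoeff _ (homogenize K Y ⁅a, b⁆) 0 = 0
        rw [LieHom.map_lie, tensorCoeff_lie]
        simp [ha] } (fun y => ?_) f
  change tensorCoeff _ (homogenize K Y (of K y)) 0 = 0
  rw [homogenize, lift_of_apply, tensorCoeff_tmul]
  simp

/-- Free Lie algebras are residually nilpotent. -/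
theorem eq_bot_of_le_span_lie (R : Submodule K (FreeLieAlgebra K Y))
    (hR : R ≤ Submodule.span K {z | ∃ x : FreeLieAlgebra K Y, ∃ r ∈ R, ⁅x, r⁆ = z}) : R = ⊥ := by
  -- Each rewriting of an element of `R` as a sum of brackets `⁅x, r⁆` gains one power of `X`, so
  -- elements of `R` have arbitrarily high order in `X`.
  have key (n : ℕ) : ∀ r ∈ R, ∀ m < n, tensorCoeff _ (homogenize K Y r) m = 0 := by
    induction n with
    | zero => simp
    | succ n ih =>
      intro r hr m hm
      replace hr := hR hr
      induction hr using Submodule.span_induction with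
      | mem z hz =>
        obtain ⟨x, r, hr, rfl⟩ := hz
        rw [LieHom.map_lie, tensorCoeff_lie]
        refine Finset.sum_eq_zero fun p hp => ?_
        rw [Finset.HasAntidiagonal.mem_antidiagonal] at hp
        rcases Nat.eq_zero_or_pos p.1 with h | h
        · rw [h, tensorCoeff_homogenize_zero, zero_lie]
        · rw [ih r hr p.2 (by lia), lie_zero]
      | zero => simp
      | add a b _ _ ha hb => simp [ha, hb]
      | smul c a _ ha => simp [ha]
  rw [eq_bot_iff]
  intro r hr
  refine homogenize_injective ?_
  rw [map_zero]
  refine (tensorCoeff (FreeLieAlgebra K Y)).injective ?_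
  ext1 m
  rw [map_zero, key (m + 1) r hr m (Nat.lt_succ_self m), Finsupp.zero_apply]

end Field

end FreeLieAlgebra

/-- A Lie algebra freely generated by a family of elements is free. -/
theorem isFreeLieAlgebra_of_bijective_lift {K L Y : Type*} [Field K] [LieRing L] [LieAlgebra K L]
    (u : Y → L) (hu : Function.Bijective (FreeLieAlgebra.lift K u)) : IsFreeLieAlgebra K L := by
  have hinj : Function.Injective u := fun x y h =>
    FreeLieAlgebra.of_injective (K := K) (hu.1 (by simpa using h))
  let e : Y ≃ Set.range u := Equiv.ofInjective u hinj
  refine ⟨Set.range u, ?_⟩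
  let a : FreeLieAlgebra K Y →ₗ⁅K⁆ FreeLieAlgebra K (Set.range u) :=
    FreeLieAlgebra.lift K fun y => FreeLieAlgebra.of K (e y)
  let b : FreeLieAlgebra K (Set.range u) →ₗ⁅K⁆ FreeLieAlgebra K Y :=
    FreeLieAlgebra.lift K fun x => FreeLieAlgebra.of K (e.symm x)
  have hab : a.comp b = LieHom.id := by
    ext x
    simp [a, b]
  have hba : b.comp a = LieHom.id := by
    ext x
    simp [a, b]
  have hb : Function.Bijective b := Function.bijective_iff_has_inverse.2
    ⟨a, fun x => LieHom.congr_fun hab x, fun x => LieHom.congr_fun hba x⟩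
  have h : FreeLieAlgebra.lift K (fun x : Set.range u => (x : L)) =
      (FreeLieAlgebra.lift K u).comp b := by
    ext x
    simp only [FreeLieAlgebra.lift_of_apply, LieHom.comp_apply, b]
    exact congrArg Subtype.val (e.apply_symm_apply x).symm
  rw [h, LieHom.coe_comp]
  exact hu.comp hb

/-! ### Surjections between free Lie algebras. -/

namespace FreeLieAlgebra

variable {K Y L : Type*} [Field K] [LieRing L] [LieAlgebra K L]

/-- A free Lie algebra is spanned by its generators modulo brackets. -/
theorem exists_sub_linearCombination_mem (f : FreeLieAlgebra K Y) :
    ∃ c : Y →₀ K, f - Finsupp.linearCombination K (of K) c ∈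
      Submodule.span K {z | ∃ x y : FreeLieAlgebra K Y, ⁅x, y⁆ = z} := by
  refine mem_of_forall_of_mem
    { carrier := {f | ∃ c : Y →₀ K, f - Finsupp.linearCombination K (of K) c ∈
        Submodule.span K {z | ∃ x y : FreeLieAlgebra K Y, ⁅x, y⁆ = z}}
      add_mem' := ?_
      zero_mem' := ⟨0, by simp⟩
      smul_mem' := ?_
      lie_mem' := fun {a b} _ _ => ⟨0, by
        rw [map_zero, sub_zero]
        exact Submodule.subset_span ⟨a, b, rfl⟩⟩ } (fun y => ?_) f
  · rintro a b ⟨c, hc⟩ ⟨d, hd⟩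
    refine ⟨c + d, ?_⟩
    rw [map_add, add_sub_add_comm]
    exact add_mem hc hd
  · rintro t a ⟨c, hc⟩
    refine ⟨t • c, ?_⟩
    rw [map_smul, ← smul_sub]
    exact Submodule.smul_mem _ t hc
  · exact ⟨Finsupp.single y 1, by simp⟩

/-- Free Lie algebras are projective. -/
theorem _root_.IsFreeLieAlgebra.exists_section (hL : IsFreeLieAlgebra K L) {M : Type*} [LieRing M]
    [LieAlgebra K M] (φ : M →ₗ⁅K⁆ L) (hφ : Function.Surjective φ) :
    ∃ s : L →ₗ⁅K⁆ M, ∀ x, φ (s x) = x := by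
  obtain ⟨X, hX⟩ := hL
  let e := LieEquiv.ofBijective _ hX
  let t : FreeLieAlgebra K X →ₗ⁅K⁆ M := lift K fun x => Function.surjInv hφ x
  have ht : φ.comp t = lift K (fun x : X => (x : L)) := by
    ext x
    simp [t, Function.surjInv_eq]
  refine ⟨t.comp (e.symm : L →ₗ⁅K⁆ _), fun x => ?_⟩
  exact (LieHom.congr_fun ht (e.symm x)).trans (e.apply_symm_apply x)

/-- A surjection from a free Lie algebra to a free Lie algebra that is injective modulo brackets is
injective. -/
theorem injective_of_ker_le_span_lie (hL : IsFreeLieAlgebra K L)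
    (φ : FreeLieAlgebra K Y →ₗ⁅K⁆ L) (hφ : Function.Surjective φ)
    (hker : ∀ f, φ f = 0 → f ∈ Submodule.span K {z | ∃ x y : FreeLieAlgebra K Y, ⁅x, y⁆ = z}) :
    Function.Injective φ := by
  obtain ⟨s, hs⟩ := hL.exists_section φ hφ
  let R := LinearMap.ker (φ : FreeLieAlgebra K Y →ₗ[K] L)
  have hRφ : ∀ x, x - s (φ x) ∈ R := fun x => by
    change φ (x - s (φ x)) = 0
    rw [map_sub, hs, sub_self]
  have hR : R ≤ Submodule.span K {z | ∃ x : FreeLieAlgebra K Y, ∃ r ∈ R, ⁅x, r⁆ = z} := by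
    have key : ∀ f ∈ Submodule.span K {z | ∃ x y : FreeLieAlgebra K Y, ⁅x, y⁆ = z},
        f - s (φ f) ∈ Submodule.span K {z | ∃ x : FreeLieAlgebra K Y, ∃ r ∈ R, ⁅x, r⁆ = z} := by
      intro f hf
      induction hf using Submodule.span_induction with
      | mem f hf =>
        obtain ⟨x, y, rfl⟩ := hf
        -- Replace one factor at a time by its image under `s ∘ φ`; each replacement costs a bracket
        -- with an element of `R`.
        have h : ⁅x, y⁆ - s (φ ⁅x, y⁆) =
            ⁅s (φ x), y - s (φ y)⁆ - ⁅y, x - s (φ x)⁆ := by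
          rw [LieHom.map_lie, LieHom.map_lie, lie_sub, lie_sub, ← lie_skew x y,
            ← lie_skew (s (φ x)) y]
          abel
        rw [h]
        exact sub_mem (Submodule.subset_span ⟨_, _, hRφ y, rfl⟩)
          (Submodule.subset_span ⟨_, _, hRφ x, rfl⟩)
      | zero => simp
      | add a b _ _ ha hb =>
        rw [map_add, map_add, add_sub_add_comm]
        exact add_mem ha hb
      | smul t a _ ha =>
        rw [map_smul, map_smul, ← smul_sub]
        exact Submodule.smul_mem _ t ha
    intro r hr
    have h := key r (hker r hr)
    rwa [show φ r = 0 from hr, map_zero, sub_zero] at h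
  have h := eq_bot_of_le_span_lie R hR
  rw [injective_iff_map_eq_zero]
  intro f hf
  exact (Submodule.mem_bot K).1 (h ▸ (show f ∈ R from hf))

/-- A linear map that vanishes on brackets detects injectivity on generators. -/
theorem lift_injective_of_linearIndependent (hL : IsFreeLieAlgebra K L) (u : Y → L)
    (hu : Function.Surjective (lift K u)) {V : Type*} [AddCommGroup V] [Module K V] (q : L →ₗ[K] V)
    (hq : ∀ x y : L, q ⁅x, y⁆ = 0) (hind : LinearIndependent K (q ∘ u)) :
    Function.Injective (lift K u) := by
  refine injective_of_ker_le_span_lie hL _ hu fun f hf => ?_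
  obtain ⟨c, hc⟩ := exists_sub_linearCombination_mem f
  have hz : ∀ z ∈ Submodule.span K {z | ∃ x y : FreeLieAlgebra K Y, ⁅x, y⁆ = z},
      q (lift K u z) = 0 := by
    intro z hz
    induction hz using Submodule.span_induction with
    | mem z hz =>
      obtain ⟨x, y, rfl⟩ := hz
      rw [LieHom.map_lie, hq]
    | zero => simp
    | add x y _ _ hx hy => rw [map_add, map_add, hx, hy, add_zero]
    | smul t x _ hx => rw [map_smul, map_smul, hx, smul_zero]
  have hlin : lift K u (Finsupp.linearCombination K (of K) c) =
      Finsupp.linearCombination K u c := by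
    refine (Finsupp.apply_linearCombination K (lift K u : FreeLieAlgebra K Y →ₗ[K] L) _ c).trans ?_
    congr 2
    funext y
    exact lift_of_apply u y
  have h := hz _ hc
  rw [map_sub, hf, zero_sub, map_neg, neg_eq_zero, hlin, Finsupp.apply_linearCombination] at h
  -- Independence kills the linear part of `f`, which leaves only brackets.
  rwa [linearIndependent_iff.1 hind c h, map_zero, sub_zero] at hc

end FreeLieAlgebra

/-! ### Homogeneous generators of connected graded free Lie algebras. -/

/-- The union of bases of the summands is linearly independent in a direct sum. -/
theorem DirectSum.linearIndependent_lof {K ι : Type*} [Field K] [DecidableEq ι]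
    {M : ι → Type*} [∀ i, AddCommGroup (M i)]
    [∀ i, Module K (M i)] {η : ι → Type*} (b : ∀ i, Module.Basis (η i) K (M i)) :
    LinearIndependent K fun y : Σ i, η i => DirectSum.lof K ι M y.1 (b y.1 y.2) := by
  have h : (fun y : Σ i, η i => DirectSum.lof K ι M y.1 (b y.1 y.2)) = DFinsupp.basis b := by
    funext ⟨i, j⟩
    refine ((DFinsupp.basis b).apply_eq_iff.2 ?_).symm
    change sigmaFinsuppEquivDFinsupp.symm
      (DFinsupp.mapRange (fun i => (b i).repr) (fun i => map_zero _) (DFinsupp.single i (b i j))) = _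
    rw [Equiv.symm_apply_eq, sigmaFinsuppEquivDFinsupp_single, DFinsupp.mapRange_single]
    congr 1
    exact (b i).repr_self j
  rw [h]
  exact (DFinsupp.basis b).linearIndependent

section Graded

variable {K L ι : Type*} [Field K] [LieRing L] [LieAlgebra K L] [Add ι]

/-- The span of the brackets of total degree `i` of homogeneous elements. -/
def lieSpanOfDegree (A : ι → Submodule K L) (i : ι) : Submodule K L :=
  Submodule.span K {z | ∃ a b : ι, a + b = i ∧ ∃ x ∈ A a, ∃ y ∈ A b, ⁅x, y⁆ = z}

/-- Factors of weight zero vanish, so both factors of a nonzero bracket have weight strictly below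
`w i`. -/
theorem lieSpanOfDegree_le {A : ι → Submodule K L} {w : ι → ℕ}
    (hw : ∀ i j, w (i + j) = w i + w j) (h0 : ∀ i, w i = 0 → A i = ⊥)
    (S : LieSubalgebra K L) (i : ι) (hS : ∀ j, w j < w i → ∀ x ∈ A j, x ∈ S) :
    lieSpanOfDegree A i ≤ S.toSubmodule := by
  rw [lieSpanOfDegree, Submodule.span_le]
  rintro _ ⟨a, b, rfl, x, hx, y, hy, rfl⟩
  rw [hw] at hS
  rcases Nat.eq_zero_or_pos (w a) with ha | ha
  · rw [h0 a ha, Submodule.mem_bot] at hx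
    rw [hx, zero_lie]
    exact zero_mem _
  rcases Nat.eq_zero_or_pos (w b) with hb | hb
  · rw [h0 b hb, Submodule.mem_bot] at hy
    rw [hy, lie_zero]
    exact zero_mem _
  exact S.lie_mem (hS a (by lia) x hx) (hS b (by lia) y hy)

/-- In a connected graded Lie algebra, a Lie subalgebra that generates modulo brackets is
everything. -/
theorem mem_of_forall_exists_sub_mem {A : ι → Submodule K L} {w : ι → ℕ}
    (hw : ∀ i j, w (i + j) = w i + w j) (h0 : ∀ i, w i = 0 → A i = ⊥)
    (S : LieSubalgebra K L) (hS : ∀ i, ∀ x ∈ A i, ∃ v ∈ S, x - v ∈ lieSpanOfDegree A i)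
    (n : ℕ) : ∀ i, w i = n → ∀ x ∈ A i, x ∈ S := by
  induction n using Nat.strong_induction_on with
  | _ n ih =>
    rintro i rfl x hx
    obtain ⟨v, hv, hxv⟩ := hS i x hx
    have h := lieSpanOfDegree_le hw h0 S i (fun j hj => ih (w j) hj j rfl) hxv
    rw [← sub_add_cancel x v]
    exact add_mem h hv

variable [DecidableEq ι]

/-- The quotient of a graded Lie algebra by its brackets. -/
noncomputable def indecomposables {A : ι → Submodule K L} (hA : DirectSum.IsInternal A) :
    L →ₗ[K] ⨁ i, A i ⧸ (lieSpanOfDegree A i).submoduleOf (A i) :=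
  DirectSum.lmap (fun i => ((lieSpanOfDegree A i).submoduleOf (A i)).mkQ) ∘ₗ
    (LinearEquiv.ofBijective (DirectSum.coeLinearMap A) hA).symm.toLinearMap

theorem indecomposables_of_mem {A : ι → Submodule K L} (hA : DirectSum.IsInternal A) {i : ι}
    (x : A i) : indecomposables hA x = DirectSum.lof K ι
      (fun i => A i ⧸ (lieSpanOfDegree A i).submoduleOf (A i)) i (Submodule.Quotient.mk x) := by
  have h : (LinearEquiv.ofBijective (DirectSum.coeLinearMap A) hA).symm x =
      DirectSum.lof K ι (fun i => A i) i x := by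
    rw [LinearEquiv.symm_apply_eq]
    exact (DirectSum.coeLinearMap_lof A i x).symm
  rw [indecomposables, LinearMap.comp_apply, LinearEquiv.coe_coe, h, DirectSum.lmap_lof]
  rfl

theorem indecomposables_lie {A : ι → Submodule K L} (hA : DirectSum.IsInternal A)
    (hlie : ∀ {i j x y}, x ∈ A i → y ∈ A j → ⁅x, y⁆ ∈ A (i + j)) (x y : L) :
    indecomposables hA ⁅x, y⁆ = 0 := by
  have htop := hA.submodule_iSup_eq_top
  have hx : x ∈ ⨆ i, A i := htop ▸ Submodule.mem_top
  have hy : y ∈ ⨆ i, A i := htop ▸ Submodule.mem_top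
  induction hx using Submodule.iSup_induction' with
  | mem i x hx =>
    induction hy using Submodule.iSup_induction' with
    | mem j y hy =>
      have h := indecomposables_of_mem hA ⟨_, hlie hx hy⟩
      rw [h, (Submodule.Quotient.mk_eq_zero _).2, map_zero]
      exact Submodule.subset_span ⟨i, j, rfl, x, hx, y, hy, rfl⟩
    | zero => simp
    | add y y' _ _ h h' => rw [lie_add, map_add, h, h', add_zero]
  | zero => simp
  | add x x' _ _ h h' => rw [add_lie, map_add, h, h', add_zero]

end Graded

/-- A connected graded Lie algebra that is free is freely generated by homogeneous elements. -/
theorem IsFreeLieAlgebra.exists_homogeneous_generators {K : Type*} {L : Type u} {ι : Type v}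
    [Field K] [LieRing L] [LieAlgebra K L] [Add ι] [DecidableEq ι] (hL : IsFreeLieAlgebra K L)
    {A : ι → Submodule K L} (hA : DirectSum.IsInternal A)
    (hlie : ∀ {i j x y}, x ∈ A i → y ∈ A j → ⁅x, y⁆ ∈ A (i + j))
    {w : ι → ℕ} (hw : ∀ i j, w (i + j) = w i + w j) (h0 : ∀ i, w i = 0 → A i = ⊥) :
    ∃ (Y : Type max u v) (d : Y → ι) (u : Y → L), (∀ y, u y ∈ A (d y)) ∧
      Function.Bijective (FreeLieAlgebra.lift K u) := by
  let b := fun i => Module.Basis.ofVectorSpace K (A i ⧸ (lieSpanOfDegree A i).submoduleOf (A i))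
  choose r hr using fun i : ι => Submodule.Quotient.mk_surjective
    ((lieSpanOfDegree A i).submoduleOf (A i))
  let Y : Type max u v := Σ i, Module.Basis.ofVectorSpaceIndex K
    (A i ⧸ (lieSpanOfDegree A i).submoduleOf (A i))
  let u : Y → L := fun y => r y.1 (b y.1 y.2)
  refine ⟨Y, Sigma.fst, u, fun y => Subtype.property _, ?_⟩
  have hsurj : Function.Surjective (FreeLieAlgebra.lift K u) := by
    let S := (FreeLieAlgebra.lift K u).range
    have hS : ∀ i, ∀ x ∈ A i, x ∈ S := by
      intro i
      refine mem_of_forall_exists_sub_mem hw h0 S (fun i x hx => ?_) _ i rfl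
      -- Expand the class of `x` modulo brackets in the chosen basis; `v` lifts this expansion term
      -- by term.
      let c := (b i).repr (Submodule.Quotient.mk ⟨x, hx⟩)
      let v := Finsupp.linearCombination K (fun j => r i (b i j)) c
      refine ⟨v, ?_, ?_⟩
      · rw [show (v : L) = Finsupp.linearCombination K (fun j => u ⟨i, j⟩) c from
          Finsupp.apply_linearCombination K (A i).subtype _ c, Finsupp.linearCombination_apply]
        refine Submodule.sum_mem S.toSubmodule fun j _ => Submodule.smul_mem _ _ ?_
        exact ⟨FreeLieAlgebra.of K ⟨i, j⟩, FreeLieAlgebra.lift_of_apply _ _⟩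
      · change (⟨x, hx⟩ - v : A i) ∈ (lieSpanOfDegree A i).submoduleOf (A i)
        rw [← Submodule.Quotient.mk_eq_zero, Submodule.Quotient.mk_sub, sub_eq_zero]
        refine ((b i).linearCombination_repr _).symm.trans ?_
        refine Eq.trans ?_ (Finsupp.apply_linearCombination K
          ((lieSpanOfDegree A i).submoduleOf (A i)).mkQ _ c).symm
        congr 2
        funext j
        exact (hr i _).symm
    intro x
    have hx : x ∈ ⨆ i, A i := hA.submodule_iSup_eq_top ▸ Submodule.mem_top
    exact (iSup_le (a := S.toSubmodule) fun i => hS i) hx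
  refine ⟨FreeLieAlgebra.lift_injective_of_linearIndependent hL u hsurj
    (V := ⨁ i, A i ⧸ (lieSpanOfDegree A i).submoduleOf (A i)) (indecomposables hA)
    (indecomposables_lie hA hlie) ?_, hsurj⟩
  have h : indecomposables hA ∘ u = fun y : Y => DirectSum.lof K ι
      (fun i => A i ⧸ (lieSpanOfDegree A i).submoduleOf (A i)) y.1 (b y.1 y.2) := by
    funext y
    rw [Function.comp_apply, indecomposables_of_mem, hr]
  rw [h]
  exact DirectSum.linearIndependent_lof b

/-! ### Lifting free generators from `Gr(g)` to `g`. -/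

namespace GradedFilteredLieAlgebra

variable {K g : Type*} [Field K] [LieRing g] [LieAlgebra K g] (G : GradedFilteredLieAlgebra K g)

/-- The projection of `Gr(g)` to one of its pieces. -/
noncomputable def grProj (p : ℕ × ℕ) : G.Gr →ₗ[K] G.Piece p :=
  DirectSum.component K (ℕ × ℕ) G.Piece p ∘ₗ G.grEquiv.symm.toLinearMap

theorem grProj_toGr_self (p : ℕ × ℕ) (x : G.comp p) :
    G.grProj p (G.toGr p x) = Submodule.Quotient.mk x := by
  rw [toGr_apply, grProj, LinearMap.comp_apply, LinearEquiv.coe_coe, LinearEquiv.symm_apply_apply,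
    DirectSum.component.lof_self]
  rfl

theorem grProj_toGr_of_ne {p q : ℕ × ℕ} (h : q ≠ p) (x : G.comp q) :
    G.grProj p (G.toGr q x) = 0 := by
  rw [toGr_apply, grProj, LinearMap.comp_apply, LinearEquiv.coe_coe, LinearEquiv.symm_apply_apply,
    DirectSum.component.of, dif_neg h]

/-- Turns the external sum defining `Gr(g)` into a grading by subspaces, as the search for
homogeneous generators requires. -/
theorem isInternal_range_toGr :
    DirectSum.IsInternal fun p => LinearMap.range (G.toGr p) := by
  let a : ∀ p, G.Piece p →ₗ[K] LinearMap.range (G.toGr p) := fun p =>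
    LinearMap.codRestrict _ (G.grEquiv.toLinearMap ∘ₗ DirectSum.lof K (ℕ × ℕ) G.Piece p) (by
      intro x
      obtain ⟨x, rfl⟩ := Submodule.mkQ_surjective _ x
      exact ⟨x, rfl⟩)
  have ha : ∀ p, Function.Surjective (a p) := by
    rintro p ⟨_, x, rfl⟩
    exact ⟨(G.next p).mkQ x, rfl⟩
  have hsurj : Function.Surjective (DirectSum.lmap a) := (DirectSum.lmap_surjective a).2 ha
  have h : DirectSum.coeLinearMap (fun p => LinearMap.range (G.toGr p)) ∘ₗ DirectSum.lmap a =
      G.grEquiv.toLinearMap := by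
    refine DirectSum.linearMap_ext K fun p => ?_
    ext x
    simp only [LinearMap.comp_apply, DirectSum.lmap_lof, DirectSum.coeLinearMap_lof]
    rfl
  have h2 : Function.Bijective
      (DirectSum.coeLinearMap (fun p => LinearMap.range (G.toGr p)) ∘ DirectSum.lmap a) := by
    rw [← LinearMap.coe_comp, h]
    exact G.grEquiv.bijective
  have hinj : Function.Injective (DirectSum.lmap a) := h2.1.of_comp
  exact (Function.Bijective.of_comp_iff _ ⟨hinj, hsurj⟩).1 h2

theorem lie_mem_range_toGr {p q : ℕ × ℕ} {a b : G.Gr} (ha : a ∈ LinearMap.range (G.toGr p))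
    (hb : b ∈ LinearMap.range (G.toGr q)) : ⁅a, b⁆ ∈ LinearMap.range (G.toGr (p + q)) := by
  obtain ⟨x, rfl⟩ := ha
  obtain ⟨y, rfl⟩ := hb
  exact ⟨_, (G.lie_toGr x y).symm⟩

/-- The projection of `g` to its homogeneous component of degree `n`. -/
noncomputable def degProj (n : ℕ) : g →ₗ[K] G.deg n :=
  DirectSum.component K ℕ (fun n => G.deg n) n ∘ₗ
    (LinearEquiv.ofBijective (DirectSum.coeLinearMap G.deg) G.isInternal).symm.toLinearMap

theorem degProj_of_mem {n : ℕ} {x : g} (hx : x ∈ G.deg n) : (G.degProj n x : g) = x :=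
  congrArg Subtype.val (G.isInternal.ofBijective_coeLinearMap_of_mem hx)

theorem degProj_of_ne {m n : ℕ} (h : m ≠ n) {x : g} (hx : x ∈ G.deg m) : G.degProj n x = 0 :=
  G.isInternal.ofBijective_coeLinearMap_of_mem_ne h hx

section Lift

variable {Y : Type*} {d : Y → ℕ × ℕ} (u : ∀ y, G.comp (d y))

/-- The morphism from the free Lie algebra given by elements of `g`. -/
noncomputable def liftFree : FreeLieAlgebra K Y →ₗ⁅K⁆ g :=
  FreeLieAlgebra.lift K fun y => (u y : g)

/-- The morphism from the free Lie algebra given by the classes of elements of `g`. -/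
noncomputable def liftFreeGr : FreeLieAlgebra K Y →ₗ⁅K⁆ G.Gr :=
  FreeLieAlgebra.lift K fun y => G.toGr (d y) (u y)

/-- The elements of the free Lie algebra whose image in `Gr(g)` is the class of their image in
`g`, in bidegree `p`. -/
def homogeneous (p : ℕ × ℕ) : Submodule K (FreeLieAlgebra K Y) where
  carrier := {f | ∃ x : G.comp p, (x : g) = G.liftFree u f ∧ G.toGr p x = G.liftFreeGr u f}
  add_mem' := by
    rintro a b ⟨x, hx, hx'⟩ ⟨y, hy, hy'⟩
    exact ⟨x + y, by rw [Submodule.coe_add, hx, hy, map_add], by rw [map_add, hx', hy', map_add]⟩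
  zero_mem' := ⟨0, by rw [Submodule.coe_zero, map_zero], by rw [map_zero, map_zero]⟩
  smul_mem' := by
    rintro c a ⟨x, hx, hx'⟩
    exact ⟨c • x, by rw [Submodule.coe_smul, hx, map_smul], by rw [map_smul, hx', map_smul]⟩

theorem lie_mem_homogeneous {p q : ℕ × ℕ} {a b : FreeLieAlgebra K Y}
    (ha : a ∈ G.homogeneous u p) (hb : b ∈ G.homogeneous u q) :
    ⁅a, b⁆ ∈ G.homogeneous u (p + q) := by
  obtain ⟨x, hx, hx'⟩ := ha
  obtain ⟨y, hy, hy'⟩ := hb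
  refine ⟨G.compLie x y, ?_, ?_⟩
  · rw [LieHom.map_lie, ← hx, ← hy]
    rfl
  · rw [LieHom.map_lie, ← hx', ← hy', lie_toGr]

theorem of_mem_homogeneous (y : Y) : FreeLieAlgebra.of K y ∈ G.homogeneous u (d y) :=
  ⟨u y, (FreeLieAlgebra.lift_of_apply (fun y => (u y : g)) y).symm,
    (FreeLieAlgebra.lift_of_apply (fun y => G.toGr (d y) (u y)) y).symm⟩

/-- The subspaces `homogeneous` are compatible with brackets and contain the generators, so they
span. Uniqueness of the decomposition is not needed. -/
theorem exists_homogeneous_sum (f : FreeLieAlgebra K Y) : ∃ c : ℕ × ℕ →₀ FreeLieAlgebra K Y,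
    (∀ p, c p ∈ G.homogeneous u p) ∧ ∑ p ∈ c.support, c p = f := by
  have h : f ∈ ⨆ p, G.homogeneous u p := by
    have htop := FreeLieAlgebra.iSup_eq_top (G.homogeneous u)
      (fun {_ _ _ _} ha hb => G.lie_mem_homogeneous u ha hb)
      (fun y => ⟨d y, G.of_mem_homogeneous u y⟩)
    exact htop ▸ Submodule.mem_top
  exact (Submodule.mem_iSup_iff_exists_finsupp _ _).1 h

theorem liftFree_injective (h : Function.Injective (G.liftFreeGr u)) :
    Function.Injective (G.liftFree u) := by
  rw [injective_iff_map_eq_zero]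
  intro f hf
  obtain ⟨c, hc, rfl⟩ := G.exists_homogeneous_sum u f
  suffices hz : ∀ n k, c (n, k) = 0 from Finset.sum_eq_zero fun p _ => hz p.1 p.2
  intro n k
  induction k using Nat.strong_induction_on with
  | _ k ih =>
    by_cases hs : (n, k) ∈ c.support
    swap
    · exact Finsupp.notMem_support_iff.1 hs
    obtain ⟨⟨x, h1⟩, rfl, h2⟩ := hc (n, k)
    have hsum := congrArg (fun x => (G.degProj n x : g)) hf
    simp only [map_sum, Submodule.coe_sum, map_zero, Submodule.coe_zero] at hsum
    rw [← Finset.add_sum_erase _ _ hs, G.degProj_of_mem h1.1, add_eq_zero_iff_eq_neg] at hsum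
    -- In degree `n`, the terms of lower filtration index are already zero and those of higher index
    -- lie in `fil (k + 1)`. Hence the leading term has zero class in `Gr(g)`.
    have hmem : G.liftFree u (c (n, k)) ∈ G.fil (k + 1) := by
      rw [hsum]
      refine neg_mem (Submodule.sum_mem _ fun p hp => ?_)
      have h3 : G.liftFree u (c p) ∈ G.comp p := by
        obtain ⟨x, hx, -⟩ := hc p
        exact hx ▸ x.2
      by_cases hpn : p.1 = n
      · obtain ⟨m, l⟩ := p
        obtain rfl : m = n := hpn
        rw [G.degProj_of_mem h3.1]
        rcases lt_trichotomy l k with hl | rfl | hl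
        · rw [ih l hl, map_zero]
          exact zero_mem _
        · exact absurd rfl (Finset.ne_of_mem_erase hp)
        · exact G.antitone hl h3.2
      · rw [G.degProj_of_ne hpn h3.1]
        exact zero_mem _
    rw [G.toGr_eq_zero ⟨_, h1⟩ ⟨h1.1, hmem⟩] at h2
    exact h (h2.symm.trans (map_zero _).symm)

/-- Here `j` bounds the number of filtration steps left before degree `n` dies. Subtracting an
element of the range with the same class as `x` in `Gr(g)` moves `x` one step deeper. -/
theorem mem_range_liftFree (h : Function.Surjective (G.liftFreeGr u)) {n N : ℕ}
    (hN : G.deg n ⊓ G.fil N = ⊥) (j : ℕ) :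
    ∀ k, N ≤ k + j → ∀ x ∈ G.comp (n, k), x ∈ (G.liftFree u).range := by
  induction j with
  | zero =>
    intro k hk x hx
    have hx0 : x ∈ G.deg n ⊓ G.fil N := ⟨hx.1, G.antitone hk hx.2⟩
    rw [hN, Submodule.mem_bot] at hx0
    rw [hx0]
    exact zero_mem _
  | succ j ih =>
    intro k hk x hx
    obtain ⟨f, hf⟩ := h (G.toGr (n, k) ⟨x, hx⟩)
    obtain ⟨c, hc, rfl⟩ := G.exists_homogeneous_sum u f
    have hproj : ∀ p ≠ (n, k), G.grProj (n, k) (G.liftFreeGr u (c p)) = 0 := by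
      intro p hp
      obtain ⟨_, -, h2⟩ := hc p
      rw [← h2, G.grProj_toGr_of_ne hp]
    obtain ⟨z, h1, h2⟩ := hc (n, k)
    have hsum := congrArg (G.grProj (n, k)) hf
    -- Only the bidegree `(n, k)` part of the preimage is kept; it alone accounts for the class of
    -- `x`.
    rw [map_sum, map_sum, Finset.sum_eq_single (n, k) (fun p _ hp => hproj p hp)
      (fun hs => by rw [Finsupp.notMem_support_iff.1 hs, map_zero, map_zero]), ← h2,
      G.grProj_toGr_self, G.grProj_toGr_self, eq_comm, Submodule.Quotient.eq] at hsum
    have hrange := ih (k + 1) (by lia) _ hsum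
    change x - z ∈ _ at hrange
    rw [h1] at hrange
    rw [← sub_add_cancel x (G.liftFree u (c (n, k)))]
    exact add_mem hrange ⟨_, rfl⟩

theorem liftFree_surjective (hfin : G.IsLocallyFinite)
    (h : Function.Surjective (G.liftFreeGr u)) : Function.Surjective (G.liftFree u) := by
  intro x
  have hx : x ∈ ⨆ n, G.deg n := G.isInternal.submodule_iSup_eq_top ▸ Submodule.mem_top
  refine (iSup_le (a := (G.liftFree u).range.toSubmodule) fun n x hx => ?_) hx
  obtain ⟨N, hN⟩ := hfin n
  exact G.mem_range_liftFree u h hN N 0 (by lia) x ⟨hx, G.fil_zero ▸ Submodule.mem_top⟩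

end Lift

end GradedFilteredLieAlgebra

theorem proposition3p5 {K g : Type*} [Field K] [CharZero K] [LieRing g] [LieAlgebra K g]
    (G : GradedFilteredLieAlgebra K g) (hconn : G.IsConnected) (hfin : G.IsLocallyFinite)
    (hfree : IsFreeLieAlgebra K G.Gr) : IsFreeLieAlgebra K g := by
  have h0 : ∀ p : ℕ × ℕ, p.1 = 0 → LinearMap.range (G.toGr p) = ⊥ := by
    rintro ⟨_, k⟩ rfl
    rw [LinearMap.range_eq_bot]
    ext x
    have hx : (x : g) ∈ G.deg 0 := x.2.1
    rw [hconn, Submodule.mem_bot] at hx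
    rw [show x = 0 from Subtype.ext hx, map_zero, map_zero]
  -- The weight is the degree alone: connectedness kills degree zero, whereas filtration index zero
  -- may well be nonzero.
  obtain ⟨Y, d, v, hv, hbij⟩ := hfree.exists_homogeneous_generators G.isInternal_range_toGr
    G.lie_mem_range_toGr (w := Prod.fst) (fun _ _ => rfl) h0
  choose u hu using hv
  have h : Function.Bijective (G.liftFreeGr u) := by
    rw [GradedFilteredLieAlgebra.liftFreeGr, funext hu]
    exact hbij
  exact isFreeLieAlgebra_of_bijective_lift (fun y => (u y : g))
    ⟨G.liftFree_injective u h.1, G.liftFree_surjective u hfin h.2⟩
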